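/- \textbf{Theorem (data-processed triangle inequality).} Let $P:\mathcal M_{d_A}\to\mathcal M_{d_B}$ be a linear map between complex matrix algebras that is positive (it maps positive semidefinite matrices to positive semidefinite matrices) and trace-preserving. Let $\rho,\sigma'\in\mathcal M_{d_A}$ and $\sigma\in\mathcal M_{d_B}$ be quantum states, i.e. positive semidefinite matrices of trace $1$. Then for every $\alpha\in[1,\infty]$, \[ D_\alpha\left(P(\rho)\,\|\,\sigma\right)\;\le\; D_\alpha\left(\rho\,\|\,\sigma'\right)+D_{\max}\left(P(\sigma')\,\|\,\sigma\right) \] as an inequality in $(-\infty,+\infty]$. Here, for states $\tau,\omega$ on the same space and $\log=\log_2$: for $1<\alpha<\infty$, $D_\alpha$ is the sandwiched Rényi divergence \[ D_\alpha(\tau\|\omega)=\tfrac{1}{\alpha-1}\log\operatorname{tr}\left[\left(\omega^{\frac{1-\alpha}{2\alpha}}\,\tau\,\omega^{\frac{1-\alpha}{2\alpha}}\right)^{\alpha}\right]\quad\text{if }\operatorname{supp}\tau\subseteq\operatorname{supp}\omega, \] and $+\infty$ otherwise (negative powers are taken on the support of $\omega$); $D_1(\tau\|\omega)=\operatorname{tr}[\tau(\log\tau-\log\omega)]$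 if $\operatorname{supp}\tau\subseteq\operatorname{supp}\omega$ (logarithms taken on supports), and $+\infty$ otherwise; and $D_\infty(\tau\|\omega)=D_{\max}(\tau\|\omega)=\inf\{\lambda\ge 0:\tau\le 2^{\lambda}\omega\}$, where $\le$ is the Loewner order and $\inf\emptyset=+\infty$. -/

import Mathlib

open scoped ENNReal MatrixOrder ComplexOrder

noncomputable section

namespace Quantum

variable {n : Type*} [Fintype n] [DecidableEq n]

/-- A quantum state (density matrix): a positive semidefinite matrix of trace one. -/
structure IsState (ρ : Matrix n n ℂ) : Prop where
  posSemidef : ρ.PosSemidef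
  trace_eq_one : ρ.trace = 1

/-- The support of a Hermitian matrix, i.e. the span of the eigenvectors with nonzero
eigenvalue, which is its range. -/
def supp (A : Matrix n n ℂ) : Submodule ℂ (n → ℂ) := LinearMap.range A.mulVecLin

/-- The real power `A ^ s` of a positive semidefinite matrix, by functional calculus.
For `s ≠ 0` one has `0 ^ s = 0`, so the kernel of `A` is kept and negative powers are powers of
the Moore-Penrose pseudo-inverse. -/
def psdPow (A : Matrix n n ℂ) (s : ℝ) : Matrix n n ℂ := cfc (fun x : ℝ => x ^ s) A

/-- The binary logarithm of a positive semidefinite matrix, by functional calculus, taken on the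
support (`Real.logb 2 0 = 0`). -/
def psdLog (A : Matrix n n ℂ) : Matrix n n ℂ := cfc (fun x : ℝ => Real.logb 2 x) A

open Classical in
/-- The sandwiched Rényi divergence of real order `α ∈ (1, ∞)`. -/
def sandwichedRenyi (α : ℝ) (ρ σ : Matrix n n ℂ) : EReal :=
  if supp ρ ≤ supp σ then
    (((α - 1)⁻¹ * Real.logb 2
      (psdPow (psdPow σ ((1 - α) / (2 * α)) * ρ * psdPow σ ((1 - α) / (2 * α))) α).trace.re : ℝ) :
        EReal)
  else ⊤

open Classical in
/-- The (Umegaki) relative entropy `tr[ρ (log ρ - log σ)]`. -/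
def relEntropy (ρ σ : Matrix n n ℂ) : EReal :=
  if supp ρ ≤ supp σ then (((ρ * (psdLog ρ - psdLog σ)).trace.re : ℝ) : EReal) else ⊤

/-- The max-relative entropy `inf {l ≥ 0 : ρ ≤ 2 ^ l σ}` in the Loewner order; the infimum over
the empty set is `⊤`. -/
def Dmax (ρ σ : Matrix n n ℂ) : EReal :=
  ⨅ (l : ℝ) (_ : 0 ≤ l ∧ ρ ≤ ((2 : ℝ) ^ l) • σ), (l : EReal)

open Classical in
/-- The divergence `D_α` for `α ∈ [1, ∞]`: the relative entropy at `α = 1`, the max-relative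
entropy at `α = ∞`, and the sandwiched Rényi divergence in between. -/
def renyiDiv (α : ℝ≥0∞) (ρ σ : Matrix n n ℂ) : EReal :=
  if α = 1 then relEntropy ρ σ
  else if α = ∞ then Dmax ρ σ
  else sandwichedRenyi α.toReal ρ σ

end Quantum

end

/-!
The inequality follows from one complex interpolation argument covering all finite `α`.

Let `Φ` be the positive trace-preserving map, let `Φ T ≤ c S` with `T = σ'`, `S = σ` and
`c = 2 ^ l` for an exponent `l` feasible in `Dmax (Φ σ') σ`. For positive semidefinite `R` and `W`
consider the function

  `F z = tr [S ^ ((z - 1) / 2) W ^ (1 - z) S ^ ((z - 1) / 2) Φ (T ^ ((1 - z) / 2) R ^ z T ^ ((1 - z) / 2))]`,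

with all powers taken on supports (`interpFun`). It is entire and bounded on the strip
`0 ≤ re z ≤ 1`. By the Russo-Dye theorem a positive map sending `1` below `c` has norm at most `c`
on convex combinations of unitaries, and imaginary powers are such combinations
(`norm_apply_le_of_mem_convexHull_unitary`, `matPow_mem_convexHull_unitary`). Applied to
`X ↦ S ^ (-1/2) Φ (T ^ (1/2) X T ^ (1/2)) S ^ (-1/2)`, this gives `|F| ≤ c tr W` on `re z = 0`;
applied to the trace dual of `Φ`, which is unital, it gives `|F| ≤ tr R` on `re z = 1`. The
three-lines theorem yields `|F θ| ≤ (c tr W) ^ (1 - θ) (tr R) ^ θ` (`norm_interpFun_le`).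

* For `1 < α < ∞`, let `A` and `Y` be the sandwiched matrices of `(ρ, σ')` and `(Φ ρ, σ)`. With
  `R = A ^ α`, `W = Y ^ α` and `θ = 1 / α` one has `F θ = tr (Y ^ α)`, and the bound rearranges to
  `tr (Y ^ α) ≤ c ^ (α - 1) tr (A ^ α)` (`sandwichedRenyi_real_le`).
* For `α = 1`, take `R = ρ` and `W = Φ ρ`. Then `F θ ≤ c ^ (1 - θ)` with equality at `θ = 1`, where
  the derivative of `F` is `log 2` times the difference of the two relative entropies
  (`relEntropy_real_le`). No limit in `α` is taken.
* For `α = ∞`, the claim is the transitivity of the Loewner order together with the monotonicity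
  of `Φ`.
-/

noncomputable section

namespace Quantum

open Matrix
open scoped Matrix.Norms.L2Operator

variable {n m : Type*} [Fintype n] [DecidableEq n] [Fintype m] [DecidableEq m]

/-! ### Positive maps and the operator norm -/

/-- The hypothesis applied to `x = T y / c` is `‖T y‖ ≤ c ‖y‖`. -/
lemma norm_le_of_forall_re_le {T : Matrix n n ℂ} {c : ℝ} (hc : 0 < c)
    (h : ∀ x y : n → ℂ, 2 * (star x ⬝ᵥ T *ᵥ y).re ≤
      c * ((star x ⬝ᵥ x).re + (star y ⬝ᵥ y).re)) : ‖T‖ ≤ c := by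
  have key (x : EuclideanSpace ℂ n) : (star x.ofLp ⬝ᵥ x.ofLp).re = ‖x‖ ^ 2 := by
    have := inner_self_eq_norm_sq (𝕜 := ℂ) x
    rw [EuclideanSpace.inner_eq_star_dotProduct, dotProduct_comm] at this
    simpa using this
  rw [Matrix.cstar_norm_def]
  refine ContinuousLinearMap.opNorm_le_bound _ hc.le fun y => ?_
  set z : EuclideanSpace ℂ n := toEuclideanCLM (n := n) (𝕜 := ℂ) T y with hz
  have hz' : T *ᵥ y.ofLp = z.ofLp := by rw [hz, ofLp_toEuclideanCLM]
  have h1 := h (((c⁻¹ : ℝ) : ℂ) • z).ofLp y.ofLp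
  rw [key, key, hz', WithLp.ofLp_smul, star_smul, smul_dotProduct, norm_smul] at h1
  simp only [Complex.star_def, Complex.conj_ofReal, smul_eq_mul, Complex.re_ofReal_mul, key,
    Complex.norm_real, Real.norm_eq_abs, abs_of_pos (inv_pos.2 hc)] at h1
  have h2 : ‖z‖ ^ 2 ≤ (c * ‖y‖) ^ 2 := by
    field_simp at h1
    nlinarith
  exact (pow_le_pow_iff_left₀ (norm_nonneg _) (by positivity) two_ne_zero).1 h2

/-- A Cauchy-Schwarz inequality in additive form, obtained by expanding the positive
semidefinite form `M` at `x - u y`. -/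
lemma PosSemidef.two_mul_re_le {k : Type*} [Fintype k] {M : Matrix k k ℂ} (hM : M.PosSemidef)
    {u : ℂ} (hu : ‖u‖ = 1) (x y : k → ℂ) :
    2 * (u * (star x ⬝ᵥ M *ᵥ y)).re ≤ (star x ⬝ᵥ M *ᵥ x).re + (star y ⬝ᵥ M *ᵥ y).re := by
  have h0 := (Complex.le_def.1 (hM.dotProduct_mulVec_nonneg (x - u • y))).1
  have h1 : star y ⬝ᵥ M *ᵥ x = star (star x ⬝ᵥ M *ᵥ y) := by
    rw [star_dotProduct, star_mulVec, hM.1.eq, ← dotProduct_mulVec]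
  have h2 : star u * u = 1 := by
    rw [Complex.star_def, Complex.conj_mul', hu]; simp
  have h3 : star (x - u • y) ⬝ᵥ M *ᵥ (x - u • y) =
      star x ⬝ᵥ M *ᵥ x - u * (star x ⬝ᵥ M *ᵥ y) - star (u * (star x ⬝ᵥ M *ᵥ y))
        + star y ⬝ᵥ M *ᵥ y := by
    rw [star_mul', ← h1]
    simp only [star_sub, star_smul, mulVec_sub, mulVec_smul, sub_dotProduct, dotProduct_sub,
      smul_dotProduct, dotProduct_smul, smul_eq_mul]
    linear_combination (star y ⬝ᵥ M *ᵥ y) * h2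
  rw [h3] at h0
  simp only [Complex.zero_re, Complex.add_re, Complex.sub_re, Complex.star_def,
    Complex.conj_re] at h0
  linarith

/-- The spectral decomposition of a unitary matrix: a combination, with unimodular coefficients,
of positive semidefinite matrices adding up to `1`. -/
lemma exists_unimodular_decomposition {U : Matrix n n ℂ} (hU : U ∈ unitary (Matrix n n ℂ)) :
    ∃ (s : Finset ℂ) (p : ℂ → Matrix n n ℂ), (∀ w ∈ s, ‖w‖ = 1) ∧ (∀ w, (p w).PosSemidef) ∧
      ∑ w ∈ s, p w = 1 ∧ U = ∑ w ∈ s, w • p w := by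
  classical
  have hfin := U.finite_spectrum
  have hn : IsStarNormal U := ⟨by
    rw [Commute, SemiconjBy, (Unitary.mem_iff.1 hU).1, (Unitary.mem_iff.1 hU).2]⟩
  have hcont (f : ℂ → ℂ) : ContinuousOn f (spectrum ℂ U) := hfin.continuousOn f
  let e : ℂ → ℂ → ℂ := fun w v => if v = w then 1 else 0
  refine ⟨hfin.toFinset, fun w => cfc (e w) U, ?_, fun w => ?_, ?_, ?_⟩
  · intro w hw
    have := Unitary.spectrum_subset_circle ⟨U, hU⟩ (hfin.mem_toFinset.1 hw)
    simpa using this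
  · have : cfc (e w) U = (cfc (e w) U)ᴴ * cfc (e w) U := by
      rw [← star_eq_conjTranspose, ← cfc_star, ← cfc_mul _ _ _ (hcont _) (hcont _)]
      congr 1
      ext v
      by_cases h : v = w <;> simp [e, h]
    beta_reduce
    rw [this]
    exact posSemidef_conjTranspose_mul_self _
  · rw [← cfc_sum _ _ _ (fun _ _ => hcont _), ← cfc_one ℂ U]
    refine cfc_congr fun v hv => ?_
    have hv' := hfin.mem_toFinset.2 hv
    simp [e, hv]
  · have : ∀ w : ℂ, w • cfc (e w) U = cfc (fun v => w • e w v) U := fun w =>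
      (cfc_smul w (e w) U (hcont _)).symm
    simp_rw [this]
    rw [← cfc_sum _ _ _ (fun _ _ => hcont _)]
    conv_lhs => rw [← cfc_id ℂ U]
    refine cfc_congr fun v hv => ?_
    simp [e, hv]

/-- The **Russo-Dye theorem** for matrices: a positive map `Φ` with `Φ 1 ≤ c` has norm at most `c`
on convex combinations of unitaries. -/
lemma norm_apply_le_of_mem_convexHull_unitary {Φ : Matrix n n ℂ →ₗ[ℂ] Matrix m m ℂ}
    (hΦ : ∀ X, X.PosSemidef → (Φ X).PosSemidef) {c : ℝ} (hc : 0 < c)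
    (h1 : (c • (1 : Matrix m m ℂ) - Φ 1).PosSemidef) {K : Matrix n n ℂ}
    (hK : K ∈ convexHull ℝ (unitary (Matrix n n ℂ) : Set (Matrix n n ℂ))) : ‖Φ K‖ ≤ c := by
  suffices h : convexHull ℝ (unitary (Matrix n n ℂ) : Set (Matrix n n ℂ)) ⊆
      (Φ.restrictScalars ℝ) ⁻¹' Metric.closedBall 0 c by
    simpa using h hK
  refine convexHull_min (fun U hU => ?_)
    ((convex_closedBall (0 : Matrix m m ℂ) c).linear_preimage _)
  obtain ⟨s, p, hs, hp, hsum, hUs⟩ := exists_unimodular_decomposition hU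
  simp only [Set.mem_preimage, LinearMap.coe_restrictScalars, mem_closedBall_zero_iff]
  refine norm_le_of_forall_re_le hc fun x y => ?_
  have hq (z : m → ℂ) : ∑ w ∈ s, (star z ⬝ᵥ Φ (p w) *ᵥ z).re ≤ c * (star z ⬝ᵥ z).re := by
    have h2 := (Complex.le_def.1 (h1.dotProduct_mulVec_nonneg z)).1
    have h3 : Φ 1 = ∑ w ∈ s, Φ (p w) := by rw [← hsum, map_sum]
    rw [h3, sub_mulVec, dotProduct_sub, smul_mulVec, one_mulVec,
      dotProduct_smul, sum_mulVec, dotProduct_sum] at h2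
    simpa using h2
  calc 2 * (star x ⬝ᵥ Φ U *ᵥ y).re
      = ∑ w ∈ s, 2 * (w * (star x ⬝ᵥ Φ (p w) *ᵥ y)).re := by
        rw [hUs, map_sum, sum_mulVec, dotProduct_sum, Complex.re_sum, Finset.mul_sum]
        simp only [map_smul, smul_mulVec, dotProduct_smul, smul_eq_mul]
    _ ≤ ∑ w ∈ s, ((star x ⬝ᵥ Φ (p w) *ᵥ x).re + (star y ⬝ᵥ Φ (p w) *ᵥ y).re) :=
        Finset.sum_le_sum fun w hw => PosSemidef.two_mul_re_le (hΦ _ (hp w)) (hs w hw) x y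
    _ ≤ c * ((star x ⬝ᵥ x).re + (star y ⬝ᵥ y).re) := by
        rw [Finset.sum_add_distrib, mul_add]
        exact add_le_add (hq x) (hq y)

lemma mul_mem_convexHull_unitary {K L : Matrix n n ℂ}
    (hK : K ∈ convexHull ℝ (unitary (Matrix n n ℂ) : Set (Matrix n n ℂ)))
    (hL : L ∈ convexHull ℝ (unitary (Matrix n n ℂ) : Set (Matrix n n ℂ))) :
    K * L ∈ convexHull ℝ (unitary (Matrix n n ℂ) : Set (Matrix n n ℂ)) := by
  -- Freeze the left factor first among unitaries, then anywhere in the hull.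
  have h1 {U : Matrix n n ℂ} (hU : U ∈ unitary (Matrix n n ℂ)) :
      U * L ∈ convexHull ℝ (unitary (Matrix n n ℂ) : Set (Matrix n n ℂ)) := by
    have := convexHull_min (t := LinearMap.mulLeft ℝ U ⁻¹'
      convexHull ℝ (unitary (Matrix n n ℂ) : Set (Matrix n n ℂ)))
      (fun V hV => subset_convexHull ℝ _ (mul_mem hU hV))
      ((convex_convexHull ℝ _).linear_preimage _)
    exact this hL
  have := convexHull_min (t := LinearMap.mulRight ℝ L ⁻¹'
    convexHull ℝ (unitary (Matrix n n ℂ) : Set (Matrix n n ℂ)))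
    (fun V hV => h1 hV) ((convex_convexHull ℝ _).linear_preimage _)
  exact this hK

lemma norm_le_one_of_mem_convexHull_unitary {K : Matrix n n ℂ}
    (hK : K ∈ convexHull ℝ (unitary (Matrix n n ℂ) : Set (Matrix n n ℂ))) : ‖K‖ ≤ 1 :=
  norm_apply_le_of_mem_convexHull_unitary (Φ := LinearMap.id) (fun _ h => h) one_pos
    (by simpa using PosSemidef.zero) hK

lemma norm_diag_le (M : Matrix n n ℂ) (i : n) : ‖M i i‖ ≤ ‖M‖ := by
  have h := Matrix.l2_opNorm_mulVec M (EuclideanSpace.single i (1 : ℂ))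
  rw [PiLp.norm_single, norm_one, mul_one] at h
  refine le_trans ?_ h
  have := PiLp.norm_apply_le
    ((EuclideanSpace.equiv n ℂ).symm (M *ᵥ (EuclideanSpace.single i (1 : ℂ)).ofLp)) i
  simpa using this

lemma norm_trace_mul_le {R : Matrix n n ℂ} (hR : R.PosSemidef) (X : Matrix n n ℂ) :
    ‖(R * X).trace‖ ≤ R.trace.re * ‖X‖ := by
  set U := hR.1.eigenvectorUnitary
  have h1 : (R * X).trace = ∑ i, (hR.1.eigenvalues i : ℂ) * (star U.1 * X * U.1) i i := by
    conv_lhs => rw [hR.1.spectral_theorem, Unitary.conjStarAlgAut_apply]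
    rw [mul_assoc, mul_assoc, trace_mul_comm, mul_assoc, trace]
    simp [U, diagonal_mul, mul_assoc]
  rw [h1, hR.1.trace_eq_sum_eigenvalues, Complex.re_sum, Finset.sum_mul]
  refine (norm_sum_le _ _).trans (Finset.sum_le_sum fun i _ => ?_)
  rw [norm_mul]
  have hi := hR.eigenvalues_nonneg i
  have h2 : ‖(star U.1 * X * U.1) i i‖ ≤ ‖X‖ := by
    refine (norm_diag_le _ i).trans_eq ?_
    rw [CStarRing.norm_mul_coe_unitary, ← Unitary.coe_star, CStarRing.norm_coe_unitary_mul]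
  simpa [abs_of_nonneg hi] using mul_le_mul_of_nonneg_left h2 hi

/-- The adjoint of a linear map of matrices for the bilinear pairing `(X, Y) ↦ tr (X Y)`. -/
def traceDual (Φ : Matrix n n ℂ →ₗ[ℂ] Matrix m m ℂ) : Matrix m m ℂ →ₗ[ℂ] Matrix n n ℂ where
  toFun H := Matrix.of fun i j => (H * Φ (Matrix.single j i 1)).trace
  map_add' H K := by ext; simp [add_mul]
  map_smul' a H := by ext; simp

lemma trace_traceDual_mul (Φ : Matrix n n ℂ →ₗ[ℂ] Matrix m m ℂ) (H : Matrix m m ℂ)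
    (X : Matrix n n ℂ) : (traceDual Φ H * X).trace = (H * Φ X).trace := by
  have hX : X = ∑ i, ∑ j, X i j • Matrix.single i j (1 : ℂ) := by
    conv_lhs => rw [matrix_eq_sum_single X]
    simp only [smul_single, smul_eq_mul, mul_one]
  conv_rhs => rw [hX]
  have h : (H * Φ (∑ i, ∑ j, X i j • Matrix.single i j (1 : ℂ))).trace =
      ∑ i, ∑ j, X i j * (H * Φ (Matrix.single i j 1)).trace := by
    simp only [map_sum, map_smul, Matrix.mul_sum, trace_sum, Matrix.mul_smul, trace_smul,
      smul_eq_mul]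
  rw [h]
  simp only [trace, diag_apply, mul_apply, traceDual, LinearMap.coe_mk, AddHom.coe_mk, of_apply]
  rw [Finset.sum_comm]
  refine Finset.sum_congr rfl fun i _ => Finset.sum_congr rfl fun j _ => ?_
  ring

lemma PosSemidef.trace_mul_nonneg {M N : Matrix n n ℂ} (hM : M.PosSemidef) (hN : N.PosSemidef) :
    0 ≤ (M * N).trace := by
  obtain ⟨C, rfl⟩ := CStarAlgebra.nonneg_iff_eq_star_mul_self.1 hM.nonneg
  rw [mul_assoc, trace_mul_comm]
  exact (hN.mul_mul_conjTranspose_same C).trace_nonneg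

lemma PosSemidef.mul_eq_zero_of_trace_mul_eq_zero {M N : Matrix n n ℂ} (hM : M.PosSemidef)
    (hN : N.PosSemidef) (h : (M * N).trace = 0) : M * N = 0 := by
  obtain ⟨C, rfl⟩ := CStarAlgebra.nonneg_iff_eq_star_mul_self.1 hM.nonneg
  obtain ⟨D, rfl⟩ := CStarAlgebra.nonneg_iff_eq_mul_star_self.1 hN.nonneg
  have h1 : ((C * D)ᴴ * (C * D)).trace = 0 := by
    rw [← h, conjTranspose_mul, trace_mul_comm (star C * C)]
    simp only [star_eq_conjTranspose, mul_assoc]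
    rw [trace_mul_comm D]
    simp only [mul_assoc]
  rw [trace_conjTranspose_mul_self_eq_zero_iff] at h1
  rw [mul_assoc, ← mul_assoc C, h1]
  simp

lemma traceDual_posSemidef {Φ : Matrix n n ℂ →ₗ[ℂ] Matrix m m ℂ}
    (hΦ : ∀ X, X.PosSemidef → (Φ X).PosSemidef) {H : Matrix m m ℂ} (hH : H.PosSemidef) :
    (traceDual Φ H).PosSemidef := by
  rw [← isPositive_toEuclideanLin_iff, LinearMap.isPositive_iff_complex]
  intro x
  have h : inner ℂ (toEuclideanLin (traceDual Φ H) x) x =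
      star (H * Φ (vecMulVec x.ofLp (star x.ofLp))).trace := by
    rw [← trace_traceDual_mul, EuclideanSpace.inner_eq_star_dotProduct, mul_vecMulVec,
      trace_vecMulVec, ← star_dotProduct_star, star_star]
    rfl
  have h0 := PosSemidef.trace_mul_nonneg hH (hΦ _ (posSemidef_vecMulVec_self_star x.ofLp))
  rw [h]
  obtain ⟨h1, h2⟩ := Complex.le_def.1 h0
  refine ⟨Complex.ext (by simp) ?_, by simpa using h1⟩
  simp only [Complex.zero_im] at h2
  simp [← h2]

lemma traceDual_one {Φ : Matrix n n ℂ →ₗ[ℂ] Matrix m m ℂ} (hΦ : ∀ X, (Φ X).trace = X.trace) :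
    traceDual Φ 1 = 1 := by
  ext i j
  by_cases h : i = j
  · subst h; simp [traceDual, hΦ]
  · simp [traceDual, hΦ, h, trace_single_eq_of_ne j i (1 : ℂ) (Ne.symm h)]

/-! ### Complex functions and powers of Hermitian matrices -/

/-- The matrix `f(A)`, for `A` Hermitian and a complex function `f` of the eigenvalues, in an
eigenbasis of `A`. No continuity of `f` is needed, the spectrum being finite. -/
def spectralFun {A : Matrix n n ℂ} (hA : A.IsHermitian) (f : ℝ → ℂ) : Matrix n n ℂ :=
  hA.eigenvectorUnitary * diagonal (fun i => f (hA.eigenvalues i)) *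
    star (hA.eigenvectorUnitary : Matrix n n ℂ)

/-- The complex power of a real number, with `0 ^ z = 0` for every `z`, including `z = 0`. It is
holomorphic in `z` and additive in the exponent for every base. -/
def cpowSupp (z : ℂ) (x : ℝ) : ℂ := if x = 0 then 0 else (x : ℂ) ^ z

/-- The complex power `A ^ z` of a Hermitian matrix on its support, extended by zero on the kernel.
In particular `A ^ 0` is the projection onto the support. -/
def matPow {A : Matrix n n ℂ} (hA : A.IsHermitian) (z : ℂ) : Matrix n n ℂ :=
  spectralFun hA (cpowSupp z)

lemma spectralFun_mul {A : Matrix n n ℂ} (hA : A.IsHermitian) (f g : ℝ → ℂ) :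
    spectralFun hA f * spectralFun hA g = spectralFun hA (fun x => f x * g x) := by
  have h : star (hA.eigenvectorUnitary : Matrix n n ℂ) * hA.eigenvectorUnitary = 1 :=
    Unitary.coe_star_mul_self _
  simp only [spectralFun]
  rw [← diagonal_mul_diagonal]
  simp only [mul_assoc]
  rw [← mul_assoc (star _) (hA.eigenvectorUnitary : Matrix n n ℂ), h, one_mul]

lemma spectralFun_congr {A : Matrix n n ℂ} (hA : A.IsHermitian) {f g : ℝ → ℂ}
    (h : ∀ i, f (hA.eigenvalues i) = g (hA.eigenvalues i)) :
    spectralFun hA f = spectralFun hA g := by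
  simp only [spectralFun, h]

lemma spectralFun_ofReal {A : Matrix n n ℂ} (hA : A.IsHermitian) (f : ℝ → ℝ) :
    spectralFun hA (fun x => (f x : ℂ)) = cfc f A := by
  rw [hA.cfc_eq, IsHermitian.cfc, Unitary.conjStarAlgAut_apply]
  rfl

lemma spectralFun_add {A : Matrix n n ℂ} (hA : A.IsHermitian) (f g : ℝ → ℂ) :
    spectralFun hA (fun x => f x + g x) = spectralFun hA f + spectralFun hA g := by
  simp only [spectralFun, ← add_mul, ← mul_add, diagonal_add]

lemma spectralFun_smul {A : Matrix n n ℂ} (hA : A.IsHermitian) (c : ℂ) (f : ℝ → ℂ) :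
    spectralFun hA (fun x => c * f x) = c • spectralFun hA f := by
  have : diagonal (fun i => c * f (hA.eigenvalues i)) =
      c • diagonal (fun i => f (hA.eigenvalues i)) := by
    rw [← diagonal_smul]; rfl
  simp only [spectralFun, this, Matrix.mul_smul, Matrix.smul_mul]

lemma spectralFun_conjTranspose {A : Matrix n n ℂ} (hA : A.IsHermitian) (f : ℝ → ℂ) :
    (spectralFun hA f)ᴴ = spectralFun hA (fun x => star (f x)) := by
  simp only [spectralFun, conjTranspose_mul, star_eq_conjTranspose, conjTranspose_conjTranspose,
    diagonal_conjTranspose, mul_assoc]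
  rfl

lemma spectralFun_one {A : Matrix n n ℂ} (hA : A.IsHermitian) :
    spectralFun hA (fun _ => 1) = 1 := by
  simp [spectralFun]

lemma spectralFun_id {A : Matrix n n ℂ} (hA : A.IsHermitian) :
    spectralFun hA (fun x => (x : ℂ)) = A := by
  rw [spectralFun_ofReal hA (fun x => x), cfc_id' ℝ A]

lemma spectralFun_posSemidef {A : Matrix n n ℂ} (hA : A.IsHermitian) {f : ℝ → ℂ}
    (h : ∀ i, 0 ≤ f (hA.eigenvalues i)) : (spectralFun hA f).PosSemidef := by
  have := (PosSemidef.diagonal (d := fun i => f (hA.eigenvalues i)) h).mul_mul_conjTranspose_same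
    (hA.eigenvectorUnitary : Matrix n n ℂ)
  exact this

lemma norm_spectralFun_le {A : Matrix n n ℂ} (hA : A.IsHermitian) {f : ℝ → ℂ} {C : n → ℝ}
    (h : ∀ i, ‖f (hA.eigenvalues i)‖ ≤ C i) : ‖spectralFun hA f‖ ≤ ∑ i, C i := by
  have h0 (i) : 0 ≤ C i := (norm_nonneg _).trans (h i)
  rw [spectralFun, ← Unitary.coe_star, CStarRing.norm_mul_coe_unitary,
    CStarRing.norm_coe_unitary_mul, l2_opNorm_diagonal]
  refine (pi_norm_le_iff_of_nonneg (Finset.sum_nonneg fun i _ => h0 i)).2 fun i => ?_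
  exact (h i).trans (Finset.single_le_sum (fun i _ => h0 i) (Finset.mem_univ i))

lemma hasDerivAt_spectralFun {A : Matrix n n ℂ} (hA : A.IsHermitian) {f : ℂ → ℝ → ℂ}
    {f' : ℝ → ℂ} {z : ℂ} (h : ∀ x, HasDerivAt (fun w => f w x) (f' x) z) :
    HasDerivAt (fun w => spectralFun hA (f w)) (spectralFun hA f') z := by
  have h1 : HasDerivAt (fun w => fun i => f w (hA.eigenvalues i))
      (fun i => f' (hA.eigenvalues i)) z := hasDerivAt_pi.2 fun i => h _
  have h2 := (LinearMap.toContinuousLinearMap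
    (diagonalLinearMap n ℂ ℂ)).hasFDerivAt.comp_hasDerivAt z h1
  exact (h2.const_mul (hA.eigenvectorUnitary : Matrix n n ℂ)).mul_const
    (star (hA.eigenvectorUnitary : Matrix n n ℂ))

/-- Where `f` vanishes its value is the average of `1` and `-1`. -/
lemma spectralFun_mem_convexHull_unitary {A : Matrix n n ℂ} (hA : A.IsHermitian) {f : ℝ → ℂ}
    (h : ∀ i, f (hA.eigenvalues i) = 0 ∨ ‖f (hA.eigenvalues i)‖ = 1) :
    spectralFun hA f ∈ convexHull ℝ (unitary (Matrix n n ℂ) : Set (Matrix n n ℂ)) := by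
  have hu {g : ℝ → ℂ} (hg : ∀ i, ‖g (hA.eigenvalues i)‖ = 1) :
      spectralFun hA g ∈ unitary (Matrix n n ℂ) := by
    rw [Unitary.mem_iff, star_eq_conjTranspose, spectralFun_conjTranspose, spectralFun_mul,
      spectralFun_mul, ← spectralFun_one hA]
    constructor <;> refine spectralFun_congr hA fun i => ?_
    · rw [Complex.star_def, Complex.conj_mul', hg]; simp
    · rw [Complex.star_def, Complex.mul_conj', hg]; simp
  have h1 : spectralFun hA (fun x => if f x = 0 then 1 else f x) ∈ unitary (Matrix n n ℂ) :=
    hu fun i => by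
      split_ifs with h0
      · simp
      · exact (h i).resolve_left h0
  have h2 : spectralFun hA (fun x => if f x = 0 then -1 else f x) ∈ unitary (Matrix n n ℂ) :=
    hu fun i => by
      split_ifs with h0
      · simp
      · exact (h i).resolve_left h0
  have h3 : spectralFun hA f =
      (1 / 2 : ℝ) • spectralFun hA (fun x => if f x = 0 then 1 else f x) +
      (1 / 2 : ℝ) • spectralFun hA (fun x => if f x = 0 then -1 else f x) := by
    rw [← Complex.coe_smul, ← Complex.coe_smul, ← spectralFun_smul, ← spectralFun_smul,
      ← spectralFun_add]
    refine spectralFun_congr hA fun i => ?_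
    by_cases h0 : f (hA.eigenvalues i) = 0
    · simp [h0]
    · simp only [h0, if_false]; push_cast; ring
  rw [h3]
  exact convex_convexHull ℝ _ (subset_convexHull ℝ _ h1) (subset_convexHull ℝ _ h2)
    (by norm_num) (by norm_num) (by norm_num)

lemma cpowSupp_mul (z w : ℂ) (x : ℝ) : cpowSupp z x * cpowSupp w x = cpowSupp (z + w) x := by
  by_cases h : x = 0
  · simp [cpowSupp, h]
  · simp [cpowSupp, h, Complex.cpow_add]

lemma cpowSupp_ofReal {x : ℝ} (hx : 0 ≤ x) {s : ℝ} (hs : s ≠ 0) :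
    cpowSupp (s : ℂ) x = ((x ^ s : ℝ) : ℂ) := by
  by_cases h : x = 0
  · simp [cpowSupp, h, Real.zero_rpow hs]
  · simp [cpowSupp, h, Complex.ofReal_cpow hx]

lemma cpowSupp_ofReal_nonneg {x : ℝ} (hx : 0 ≤ x) (s : ℝ) : 0 ≤ cpowSupp (s : ℂ) x := by
  by_cases h : x = 0
  · simp [cpowSupp, h]
  · rw [cpowSupp, if_neg h, ← Complex.ofReal_cpow hx, Complex.zero_le_real]
    positivity

lemma norm_cpowSupp {x : ℝ} (hx : 0 < x) (z : ℂ) : ‖cpowSupp z x‖ = x ^ z.re := by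
  rw [cpowSupp, if_neg hx.ne', Complex.norm_cpow_eq_rpow_re_of_pos hx]

lemma norm_cpowSupp_le {x : ℝ} (hx : 0 ≤ x) {z : ℂ} (hz : |z.re| ≤ 1) :
    ‖cpowSupp z x‖ ≤ x + x⁻¹ := by
  rcases hx.eq_or_lt with rfl | hx
  · simp [cpowSupp]
  obtain ⟨h1, h2⟩ := abs_le.1 hz
  rw [norm_cpowSupp hx]
  rcases le_total 1 x with h | h
  · have := Real.rpow_le_rpow_of_exponent_le h h2
    rw [Real.rpow_one] at this
    have := inv_pos.2 hx
    linarith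
  · have := Real.rpow_le_rpow_of_exponent_ge hx h h1
    rw [Real.rpow_neg_one] at this
    linarith

lemma hasDerivAt_cpowSupp (a b z : ℂ) (x : ℝ) :
    HasDerivAt (fun w => cpowSupp (a * w + b) x)
      (a * (cpowSupp (a * z + b) x * Complex.log x)) z := by
  by_cases h : x = 0
  · simpa [cpowSupp, h] using hasDerivAt_const z (0 : ℂ)
  · have h1 : HasDerivAt (fun w : ℂ => a * w + b) a z := by
      simpa using ((hasDerivAt_id z).const_mul a).add_const b
    have := h1.const_cpow (c := (x : ℂ)) (Or.inl (by exact_mod_cast h))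
    simp only [cpowSupp, if_neg h]
    convert this using 1
    ring

lemma matPow_mul {A : Matrix n n ℂ} (hA : A.IsHermitian) (z w : ℂ) :
    matPow hA z * matPow hA w = matPow hA (z + w) := by
  rw [matPow, matPow, spectralFun_mul]
  exact spectralFun_congr hA fun i => cpowSupp_mul _ _ _

lemma matPow_one {A : Matrix n n ℂ} (hA : A.IsHermitian) : matPow hA 1 = A := by
  conv_rhs => rw [← spectralFun_id hA]
  refine spectralFun_congr hA fun i => ?_
  by_cases h : hA.eigenvalues i = 0 <;> simp [cpowSupp, h]

lemma matPow_zero_mul {A : Matrix n n ℂ} (hA : A.IsHermitian) : matPow hA 0 * A = A := by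
  have h := matPow_mul hA 0 1
  rwa [zero_add, matPow_one] at h

lemma mul_matPow_zero {A : Matrix n n ℂ} (hA : A.IsHermitian) : A * matPow hA 0 = A := by
  have h := matPow_mul hA 1 0
  rwa [add_zero, matPow_one] at h

lemma one_sub_matPow_zero_posSemidef {A : Matrix n n ℂ} (hA : A.IsHermitian) :
    (1 - matPow hA 0).PosSemidef := by
  rw [← spectralFun_one hA, matPow, sub_eq_add_neg, ← neg_one_smul ℂ (spectralFun _ _),
    ← spectralFun_smul, ← spectralFun_add]
  refine spectralFun_posSemidef hA fun i => ?_
  by_cases h : hA.eigenvalues i = 0 <;> simp [cpowSupp, h]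

lemma matPow_posSemidef {A : Matrix n n ℂ} (hA : A.PosSemidef) (s : ℝ) :
    (matPow hA.1 (s : ℂ)).PosSemidef :=
  spectralFun_posSemidef hA.1 fun i => cpowSupp_ofReal_nonneg (hA.eigenvalues_nonneg i) s

lemma matPow_ofReal {A : Matrix n n ℂ} (hA : A.PosSemidef) {s : ℝ} (hs : s ≠ 0) :
    matPow hA.1 (s : ℂ) = psdPow A s := by
  rw [psdPow, ← spectralFun_ofReal hA.1]
  exact spectralFun_congr hA.1 fun i => cpowSupp_ofReal (hA.eigenvalues_nonneg i) hs

lemma psdPow_posSemidef {A : Matrix n n ℂ} (hA : A.PosSemidef) (s : ℝ) :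
    (psdPow A s).PosSemidef := by
  rw [psdPow, ← spectralFun_ofReal hA.1]
  exact spectralFun_posSemidef hA.1 fun i => by
    rw [Complex.zero_le_real]
    exact Real.rpow_nonneg (hA.eigenvalues_nonneg i) _

lemma psdPow_psdPow {A : Matrix n n ℂ} (hA : A.PosSemidef) (s t : ℝ) :
    psdPow (psdPow A s) t = psdPow A (s * t) := by
  have hfin : (spectrum ℝ A).Finite := A.finite_real_spectrum
  rw [psdPow, psdPow, psdPow, ← cfc_comp' (fun x : ℝ => x ^ t) (fun x : ℝ => x ^ s) A
    ((hfin.image _).continuousOn _) (hfin.continuousOn _)]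
  refine cfc_congr fun x hx => ?_
  exact (Real.rpow_mul (spectrum_nonneg_of_nonneg hA.nonneg hx) s t).symm

lemma psdPow_one {A : Matrix n n ℂ} (hA : A.PosSemidef) : psdPow A 1 = A := by
  rw [← matPow_ofReal hA one_ne_zero, Complex.ofReal_one, matPow_one]

lemma norm_matPow_le {A : Matrix n n ℂ} (hA : A.PosSemidef) {z : ℂ} (hz : |z.re| ≤ 1) :
    ‖matPow hA.1 z‖ ≤ ∑ i, (hA.1.eigenvalues i + (hA.1.eigenvalues i)⁻¹) :=
  norm_spectralFun_le hA.1 fun i => norm_cpowSupp_le (hA.eigenvalues_nonneg i) hz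

lemma matPow_mem_convexHull_unitary {A : Matrix n n ℂ} (hA : A.PosSemidef) {z : ℂ}
    (hz : z.re = 0) :
    matPow hA.1 z ∈ convexHull ℝ (unitary (Matrix n n ℂ) : Set (Matrix n n ℂ)) := by
  refine spectralFun_mem_convexHull_unitary hA.1 fun i => ?_
  rcases (hA.eigenvalues_nonneg i).eq_or_lt with h | h
  · left; simp [cpowSupp, ← h]
  · right; rw [norm_cpowSupp h, hz, Real.rpow_zero]

lemma hasDerivAt_matPow {A : Matrix n n ℂ} (hA : A.IsHermitian) (a b z : ℂ) :
    HasDerivAt (fun w => matPow hA (a * w + b))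
      (a • (matPow hA (a * z + b) * spectralFun hA (fun x => Complex.log x))) z := by
  have := hasDerivAt_spectralFun hA (fun x => hasDerivAt_cpowSupp a b z x)
  rw [matPow, spectralFun_mul, ← spectralFun_smul]
  exact this

lemma spectralFun_log {A : Matrix n n ℂ} (hA : A.PosSemidef) :
    spectralFun hA.1 (fun x => Complex.log x) = (Real.log 2 : ℂ) • psdLog A := by
  rw [psdLog, ← spectralFun_ofReal hA.1, ← spectralFun_smul]
  refine spectralFun_congr hA.1 fun i => ?_
  have h2 : (Real.log 2 : ℂ) ≠ 0 := by
    exact_mod_cast (Real.log_pos one_lt_two).ne'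
  rw [← Complex.ofReal_log (hA.eigenvalues_nonneg i), Real.logb]
  push_cast
  field_simp

/-! ### Three-lines interpolation -/

/-- The holomorphic family `S ^ ((z - 1) / 2) W ^ (1 - z) S ^ ((z - 1) / 2)`. The exponents are
written as affine functions of `z`. -/
def outerFamily {S W : Matrix m m ℂ} (hS : S.PosSemidef) (hW : W.PosSemidef) (z : ℂ) :
    Matrix m m ℂ :=
  matPow hS.1 (1 / 2 * z + -1 / 2) * matPow hW.1 (-1 * z + 1) * matPow hS.1 (1 / 2 * z + -1 / 2)

/-- The holomorphic family `T ^ ((1 - z) / 2) R ^ z T ^ ((1 - z) / 2)`. The exponents are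
written as affine functions of `z`. -/
def innerFamily {T R : Matrix n n ℂ} (hT : T.PosSemidef) (hR : R.PosSemidef) (z : ℂ) :
    Matrix n n ℂ :=
  matPow hT.1 (-1 / 2 * z + 1 / 2) * matPow hR.1 (1 * z + 0) * matPow hT.1 (-1 / 2 * z + 1 / 2)

lemma hasDerivAt_outerFamily {S W : Matrix m m ℂ} (hS : S.PosSemidef) (hW : W.PosSemidef)
    (z : ℂ) : HasDerivAt (outerFamily hS hW)
      (((1 / 2 : ℂ) • (matPow hS.1 (1 / 2 * z + -1 / 2) * spectralFun hS.1 (fun x => Complex.log x))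
          * matPow hW.1 (-1 * z + 1) +
        matPow hS.1 (1 / 2 * z + -1 / 2) *
          ((-1 : ℂ) • (matPow hW.1 (-1 * z + 1) * spectralFun hW.1 (fun x => Complex.log x)))) *
        matPow hS.1 (1 / 2 * z + -1 / 2) +
      matPow hS.1 (1 / 2 * z + -1 / 2) * matPow hW.1 (-1 * z + 1) *
        ((1 / 2 : ℂ) • (matPow hS.1 (1 / 2 * z + -1 / 2) *
          spectralFun hS.1 (fun x => Complex.log x)))) z :=
  ((hasDerivAt_matPow hS.1 _ _ z).mul (hasDerivAt_matPow hW.1 _ _ z)).mul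
    (hasDerivAt_matPow hS.1 _ _ z)

lemma hasDerivAt_innerFamily {T R : Matrix n n ℂ} (hT : T.PosSemidef) (hR : R.PosSemidef)
    (z : ℂ) : HasDerivAt (innerFamily hT hR)
      (((-1 / 2 : ℂ) •
          (matPow hT.1 (-1 / 2 * z + 1 / 2) * spectralFun hT.1 (fun x => Complex.log x))
          * matPow hR.1 (1 * z + 0) +
        matPow hT.1 (-1 / 2 * z + 1 / 2) *
          ((1 : ℂ) • (matPow hR.1 (1 * z + 0) * spectralFun hR.1 (fun x => Complex.log x)))) *
        matPow hT.1 (-1 / 2 * z + 1 / 2) +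
      matPow hT.1 (-1 / 2 * z + 1 / 2) * matPow hR.1 (1 * z + 0) *
        ((-1 / 2 : ℂ) • (matPow hT.1 (-1 / 2 * z + 1 / 2) *
          spectralFun hT.1 (fun x => Complex.log x)))) z :=
  ((hasDerivAt_matPow hT.1 _ _ z).mul (hasDerivAt_matPow hR.1 _ _ z)).mul
    (hasDerivAt_matPow hT.1 _ _ z)

/-- The pairing `tr (outerFamily z * Φ (innerFamily z))` to which the three-lines theorem is
applied. -/
def interpFun (Φ : Matrix n n ℂ →ₗ[ℂ] Matrix m m ℂ) {S W : Matrix m m ℂ} {T R : Matrix n n ℂ}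
    (hS : S.PosSemidef) (hW : W.PosSemidef) (hT : T.PosSemidef) (hR : R.PosSemidef) (z : ℂ) : ℂ :=
  (outerFamily hS hW z * Φ (innerFamily hT hR z)).trace

lemma hasDerivAt_interpFun (Φ : Matrix n n ℂ →ₗ[ℂ] Matrix m m ℂ) {S W : Matrix m m ℂ}
    {T R : Matrix n n ℂ} (hS : S.PosSemidef) (hW : W.PosSemidef) (hT : T.PosSemidef)
    (hR : R.PosSemidef) {z : ℂ} {H' : Matrix m m ℂ} {G' : Matrix n n ℂ}
    (hH : HasDerivAt (outerFamily hS hW) H' z) (hG : HasDerivAt (innerFamily hT hR) G' z) :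
    HasDerivAt (interpFun Φ hS hW hT hR)
      ((H' * Φ (innerFamily hT hR z)).trace + (outerFamily hS hW z * Φ G').trace) z := by
  have h1 := (LinearMap.toContinuousLinearMap Φ).hasFDerivAt.comp_hasDerivAt z hG
  have h2 := (LinearMap.toContinuousLinearMap (traceLinearMap m ℂ ℂ)).hasFDerivAt.comp_hasDerivAt z
    (hH.mul h1)
  rw [← trace_add]
  exact h2

variable {Φ : Matrix n n ℂ →ₗ[ℂ] Matrix m m ℂ} {S W : Matrix m m ℂ} {T R : Matrix n n ℂ}

lemma bddAbove_norm_interpFun (hS : S.PosSemidef) (hW : W.PosSemidef) (hT : T.PosSemidef)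
    (hR : R.PosSemidef) :
    BddAbove ((norm ∘ interpFun Φ hS hW hT hR) ''
      Complex.HadamardThreeLines.verticalClosedStrip 0 1) := by
  let s := ∑ i, (hS.1.eigenvalues i + (hS.1.eigenvalues i)⁻¹)
  let w := ∑ i, (hW.1.eigenvalues i + (hW.1.eigenvalues i)⁻¹)
  let t := ∑ i, (hT.1.eigenvalues i + (hT.1.eigenvalues i)⁻¹)
  let r := ∑ i, (hR.1.eigenvalues i + (hR.1.eigenvalues i)⁻¹)
  let N := ‖LinearMap.toContinuousLinearMap Φ‖
  refine ⟨(1 : Matrix m m ℂ).trace.re * (s * w * s * (N * (t * r * t))), ?_⟩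
  rintro _ ⟨z, hz, rfl⟩
  have hz' : 0 ≤ z.re ∧ z.re ≤ 1 := hz
  have e1 : (1 / 2 * z + -1 / 2 : ℂ).re = (z.re - 1) / 2 := by
    rw [show (1 / 2 * z + -1 / 2 : ℂ) = (z - 1) / (2 : ℝ) by push_cast; ring,
      Complex.div_ofReal_re]; simp
  have e2 : (-1 / 2 * z + 1 / 2 : ℂ).re = (1 - z.re) / 2 := by
    rw [show (-1 / 2 * z + 1 / 2 : ℂ) = (1 - z) / (2 : ℝ) by push_cast; ring,
      Complex.div_ofReal_re]; simp
  have b1 : ‖matPow hS.1 (1 / 2 * z + -1 / 2)‖ ≤ s :=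
    norm_matPow_le hS (by rw [e1, abs_le]; constructor <;> linarith)
  have b2 : ‖matPow hW.1 (-1 * z + 1)‖ ≤ w :=
    norm_matPow_le hW (by
      rw [abs_le]; simp only [neg_mul, one_mul, Complex.add_re, Complex.neg_re, Complex.one_re]
      constructor <;> linarith)
  have b3 : ‖matPow hT.1 (-1 / 2 * z + 1 / 2)‖ ≤ t :=
    norm_matPow_le hT (by rw [e2, abs_le]; constructor <;> linarith)
  have b4 : ‖matPow hR.1 (1 * z + 0)‖ ≤ r :=
    norm_matPow_le hR (by rw [abs_le, one_mul, add_zero]; constructor <;> linarith)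
  have hs := (norm_nonneg _).trans b1
  have hw := (norm_nonneg _).trans b2
  have ht := (norm_nonneg _).trans b3
  have hr := (norm_nonneg _).trans b4
  have h1 : ‖outerFamily hS hW z‖ ≤ s * w * s :=
    norm_mul_le_of_le (norm_mul_le_of_le b1 b2) b1
  have h2 : ‖innerFamily hT hR z‖ ≤ t * r * t :=
    norm_mul_le_of_le (norm_mul_le_of_le b3 b4) b3
  have h3 : ‖Φ (innerFamily hT hR z)‖ ≤ N * (t * r * t) :=
    ((LinearMap.toContinuousLinearMap Φ).le_opNorm _).trans
      (mul_le_mul_of_nonneg_left h2 (norm_nonneg _))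
  have h4 := norm_trace_mul_le PosSemidef.one
    (outerFamily hS hW z * Φ (innerFamily hT hR z))
  rw [one_mul] at h4
  refine h4.trans (mul_le_mul_of_nonneg_left (norm_mul_le_of_le h1 h3) ?_)
  exact (Complex.le_def.1 PosSemidef.one.trace_nonneg).1

/-- On `re z = 0` the estimate rests on the positive map `X ↦ S^(-1/2) Φ (T^(1/2) X T^(1/2))
S^(-1/2)`, which sends `1` to at most `c`. -/
lemma norm_interpFun_le_of_re_eq_zero (hΦ : ∀ X, X.PosSemidef → (Φ X).PosSemidef)
    (hS : S.PosSemidef) (hW : W.PosSemidef) (hT : T.PosSemidef) (hR : R.PosSemidef)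
    {c : ℝ} (hc : 0 < c) (hST : (c • S - Φ T).PosSemidef) {z : ℂ} (hz : z.re = 0) :
    ‖interpFun Φ hS hW hT hR z‖ ≤ c * W.trace.re := by
  have hre (a : ℝ) : (a * z).re = 0 := by simp [hz]
  let s := matPow hS.1 ((-1 / 2 : ℝ) : ℂ)
  let t := matPow hT.1 ((1 / 2 : ℝ) : ℂ)
  have hs : s.PosSemidef := matPow_posSemidef hS _
  have ht : t.PosSemidef := matPow_posSemidef hT _
  let Ψ : Matrix n n ℂ →ₗ[ℂ] Matrix m m ℂ :=
    LinearMap.mulLeftRight ℂ (s, s) ∘ₗ Φ ∘ₗ LinearMap.mulLeftRight ℂ (t, t)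
  have hΨ_apply (X) : Ψ X = s * Φ (t * X * t) * s := by simp [Ψ]
  have hΨ (X) (hX : X.PosSemidef) : (Ψ X).PosSemidef := by
    have h1 := hX.mul_mul_conjTranspose_same t
    rw [ht.1.eq] at h1
    have h2 := (hΦ _ h1).mul_mul_conjTranspose_same s
    rwa [hs.1.eq, ← hΨ_apply] at h2
  have hΨ1 : (c • (1 : Matrix m m ℂ) - Ψ 1).PosSemidef := by
    have htt : t * 1 * t = T := by
      rw [mul_one, matPow_mul, ← Complex.ofReal_add]
      norm_num [matPow_one]
    have hss : s * S * s = matPow hS.1 0 := by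
      conv_lhs => enter [1, 2]; rw [← matPow_one hS.1]
      rw [matPow_mul, matPow_mul]
      congr 1
      push_cast; ring
    have h1 := hST.mul_mul_conjTranspose_same s
    rw [hs.1.eq, mul_sub, sub_mul, Matrix.mul_smul, Matrix.smul_mul, hss] at h1
    have h2 := one_sub_matPow_zero_posSemidef hS.1
    have h3 := (h2.smul hc.le).add h1
    rw [hΨ_apply, htt]
    convert h3 using 1
    rw [smul_sub]; abel
  let K := matPow hT.1 ((-1 / 2 : ℝ) * z) * matPow hR.1 ((1 : ℝ) * z) *
    matPow hT.1 ((-1 / 2 : ℝ) * z)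
  have hK : ‖Ψ K‖ ≤ c := norm_apply_le_of_mem_convexHull_unitary hΨ hc hΨ1
    (mul_mem_convexHull_unitary (mul_mem_convexHull_unitary
      (matPow_mem_convexHull_unitary hT (hre _)) (matPow_mem_convexHull_unitary hR (hre _)))
      (matPow_mem_convexHull_unitary hT (hre _)))
  let V := matPow hS.1 ((1 / 2 : ℝ) * z)
  let D := matPow hW.1 ((-1 : ℝ) * z)
  have hV : ‖V‖ ≤ 1 := norm_le_one_of_mem_convexHull_unitary
    (matPow_mem_convexHull_unitary hS (hre _))
  have hD : ‖D‖ ≤ 1 := norm_le_one_of_mem_convexHull_unitary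
    (matPow_mem_convexHull_unitary hW (hre _))
  have hinner : innerFamily hT hR z = t * K * t := by
    have e1 : matPow hT.1 (-1 / 2 * z + 1 / 2) = t * matPow hT.1 ((-1 / 2 : ℝ) * z) := by
      rw [matPow_mul]; congr 1; push_cast; ring
    have e2 : matPow hT.1 (-1 / 2 * z + 1 / 2) = matPow hT.1 ((-1 / 2 : ℝ) * z) * t := by
      rw [matPow_mul]; congr 1; push_cast; ring
    have e3 : matPow hR.1 (1 * z + 0) = matPow hR.1 ((1 : ℝ) * z) := by simp
    rw [innerFamily, e3]
    nth_rewrite 1 [e1]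
    rw [e2]
    simp only [K, mul_assoc]
  have houter : outerFamily hS hW z = s * V * (D * W) * (V * s) := by
    have e1 : matPow hS.1 (1 / 2 * z + -1 / 2) = s * V := by
      rw [matPow_mul]; congr 1; push_cast; ring
    have e2 : matPow hS.1 (1 / 2 * z + -1 / 2) = V * s := by
      rw [matPow_mul]; congr 1; push_cast; ring
    have e3 : matPow hW.1 (-1 * z + 1) = D * W := by
      conv_rhs => rw [← matPow_one hW.1]
      rw [matPow_mul]; congr 1; push_cast; ring
    rw [outerFamily, e3]
    nth_rewrite 1 [e1]
    rw [e2]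
  have htr : interpFun Φ hS hW hT hR z = (W * (V * Ψ K * V * D)).trace := by
    rw [interpFun, hinner, houter, hΨ_apply]
    have := trace_mul_comm (s * V * D) (W * V * s * Φ (t * K * t))
    simpa only [mul_assoc] using this
  rw [htr]
  refine (norm_trace_mul_le hW _).trans ?_
  rw [mul_comm]
  refine mul_le_mul_of_nonneg_right ?_ (Complex.le_def.1 hW.trace_nonneg).1
  have := norm_mul_le_of_le (norm_mul_le_of_le (norm_mul_le_of_le hV hK) hV) hD
  simpa using this

/-- On `re z = 1` the estimate rests on the trace dual of `Φ`, a positive unital map. -/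
lemma norm_interpFun_le_of_re_eq_one (hΦ : ∀ X, X.PosSemidef → (Φ X).PosSemidef)
    (htr : ∀ X, (Φ X).trace = X.trace)
    (hS : S.PosSemidef) (hW : W.PosSemidef) (hT : T.PosSemidef) (hR : R.PosSemidef)
    {z : ℂ} (hz : z.re = 1) :
    ‖interpFun Φ hS hW hT hR z‖ ≤ R.trace.re := by
  have hre (a : ℝ) : (a * (z - 1)).re = 0 := by simp [hz]
  have e1 : matPow hS.1 (1 / 2 * z + -1 / 2) = matPow hS.1 ((1 / 2 : ℝ) * (z - 1)) := by
    congr 1; push_cast; ring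
  have e2 : matPow hW.1 (-1 * z + 1) = matPow hW.1 ((-1 : ℝ) * (z - 1)) := by
    congr 1; push_cast; ring
  have e3 : matPow hT.1 (-1 / 2 * z + 1 / 2) = matPow hT.1 ((-1 / 2 : ℝ) * (z - 1)) := by
    congr 1; push_cast; ring
  have e4 : matPow hR.1 (1 * z + 0) = R * matPow hR.1 ((1 : ℝ) * (z - 1)) := by
    have h := matPow_mul hR.1 1 ((1 : ℝ) * (z - 1))
    rw [matPow_one] at h
    rw [h]; congr 1; push_cast; ring
  have hQ : ‖traceDual Φ (outerFamily hS hW z)‖ ≤ 1 := by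
    refine norm_apply_le_of_mem_convexHull_unitary (fun X hX => traceDual_posSemidef hΦ hX)
      one_pos (by rw [traceDual_one htr, one_smul, sub_self]; exact PosSemidef.zero) ?_
    rw [outerFamily, e1, e2]
    exact mul_mem_convexHull_unitary (mul_mem_convexHull_unitary
      (matPow_mem_convexHull_unitary hS (hre _)) (matPow_mem_convexHull_unitary hW (hre _)))
      (matPow_mem_convexHull_unitary hS (hre _))
  have hV : ‖matPow hT.1 ((-1 / 2 : ℝ) * (z - 1))‖ ≤ 1 := norm_le_one_of_mem_convexHull_unitary
    (matPow_mem_convexHull_unitary hT (hre _))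
  have hD : ‖matPow hR.1 ((1 : ℝ) * (z - 1))‖ ≤ 1 := norm_le_one_of_mem_convexHull_unitary
    (matPow_mem_convexHull_unitary hR (hre _))
  have h : interpFun Φ hS hW hT hR z = (R * (matPow hR.1 ((1 : ℝ) * (z - 1)) *
      matPow hT.1 ((-1 / 2 : ℝ) * (z - 1)) * traceDual Φ (outerFamily hS hW z) *
      matPow hT.1 ((-1 / 2 : ℝ) * (z - 1)))).trace := by
    rw [interpFun, ← trace_traceDual_mul, innerFamily, e3, e4, ← mul_assoc, ← mul_assoc,
      trace_mul_cycle, trace_mul_comm]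
    simp only [mul_assoc]
  rw [h]
  refine (norm_trace_mul_le hR _).trans ?_
  refine mul_le_of_le_one_right (Complex.le_def.1 hR.trace_nonneg).1 ?_
  have := norm_mul_le_of_le (norm_mul_le_of_le (norm_mul_le_of_le hD hV) hQ) hV
  simpa using this

/-- **Interpolation** between the trace norm contraction by `Φ` and the bound `Φ T ≤ c S`. -/
theorem norm_interpFun_le (hΦ : ∀ X, X.PosSemidef → (Φ X).PosSemidef)
    (htr : ∀ X, (Φ X).trace = X.trace)
    (hS : S.PosSemidef) (hW : W.PosSemidef) (hT : T.PosSemidef) (hR : R.PosSemidef)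
    {c : ℝ} (hc : 0 < c) (hST : (c • S - Φ T).PosSemidef) {θ : ℝ} (h0 : 0 ≤ θ) (h1 : θ ≤ 1) :
    ‖interpFun Φ hS hW hT hR θ‖ ≤ (c * W.trace.re) ^ (1 - θ) * R.trace.re ^ θ := by
  have hd : Differentiable ℂ (interpFun Φ hS hW hT hR) := fun z =>
    (hasDerivAt_interpFun Φ hS hW hT hR (hasDerivAt_outerFamily hS hW z)
      (hasDerivAt_innerFamily hT hR z)).differentiableAt
  have := Complex.HadamardThreeLines.norm_le_interp_of_mem_verticalClosedStrip₀₁'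
    (interpFun Φ hS hW hT hR) (z := θ)
    (by simp [Complex.HadamardThreeLines.verticalClosedStrip, h0, h1])
    hd.diffContOnCl (bddAbove_norm_interpFun hS hW hT hR)
    (fun z hz => norm_interpFun_le_of_re_eq_zero hΦ hS hW hT hR hc hST hz)
    (fun z hz => norm_interpFun_le_of_re_eq_one hΦ htr hS hW hT hR hz)
  simpa using this

/-! ### Supports -/

lemma matPow_zero_mul_of_supp_le {ρ σ : Matrix n n ℂ} (hσ : σ.IsHermitian)
    (h : supp ρ ≤ supp σ) : matPow hσ 0 * ρ = ρ := by
  refine ext_of_mulVec_single fun i => ?_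
  obtain ⟨w, hw⟩ := h ⟨Pi.single i 1, rfl⟩
  simp only [mulVecLin_apply] at hw
  rw [← mulVec_mulVec, ← hw, mulVec_mulVec, matPow_zero_mul]

lemma mul_matPow_zero_of_supp_le {ρ σ : Matrix n n ℂ} (hρ : ρ.IsHermitian) (hσ : σ.PosSemidef)
    (h : supp ρ ≤ supp σ) : ρ * matPow hσ.1 0 = ρ := by
  have h1 := congr_arg conjTranspose (matPow_zero_mul_of_supp_le hσ.1 h)
  have h2 : (matPow hσ.1 0)ᴴ = matPow hσ.1 0 := by
    simpa using (matPow_posSemidef hσ 0).1.eq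
  rwa [conjTranspose_mul, h2, hρ.eq] at h1

/-- If `K` is the projection onto `ker σ`, then `0 ≤ tr (ω K) ≤ k tr (σ K) = 0`, so `ω K = 0`. -/
lemma supp_le_of_le_smul {ω σ : Matrix n n ℂ} (hω : ω.PosSemidef) (hσ : σ.IsHermitian) {k : ℝ}
    (h : ω ≤ k • σ) : supp ω ≤ supp σ := by
  have hK : (1 - matPow hσ 0).PosSemidef := one_sub_matPow_zero_posSemidef hσ
  have hσK : σ * (1 - matPow hσ 0) = 0 := by rw [mul_sub, mul_one, mul_matPow_zero, sub_self]
  have h1 := PosSemidef.trace_mul_nonneg (Matrix.le_iff.1 h) hK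
  rw [sub_mul, Matrix.smul_mul, hσK, smul_zero, zero_sub, trace_neg] at h1
  have h2 : (ω * (1 - matPow hσ 0)).trace = 0 :=
    le_antisymm (neg_nonneg.1 h1) (PosSemidef.trace_mul_nonneg hω hK)
  have h3 := congr_arg conjTranspose (PosSemidef.mul_eq_zero_of_trace_mul_eq_zero hω hK h2)
  rw [conjTranspose_mul, hK.1.eq, hω.1.eq, conjTranspose_zero, sub_mul, one_mul, sub_eq_zero] at h3
  have h4 : ω = σ * (matPow hσ (-1) * ω) := by
    conv_lhs => rw [h3]
    have := matPow_mul hσ 1 (-1)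
    rw [matPow_one] at this
    rw [← mul_assoc, this]
    norm_num
  rintro _ ⟨v, rfl⟩
  refine ⟨(matPow hσ (-1) * ω) *ᵥ v, ?_⟩
  simp only [mulVecLin_apply, mulVec_mulVec]
  rw [← h4]

lemma le_norm_smul_one {X : Matrix n n ℂ} (hX : X.PosSemidef) :
    X ≤ ‖X‖ • (1 : Matrix n n ℂ) := by
  have := IsSelfAdjoint.le_algebraMap_norm_self (a := X) hX.1
  rwa [Algebra.algebraMap_eq_smul_one] at this

/-- With `X = σ ^ (-1/2) ρ σ ^ (-1/2) ≤ ‖X‖`, the inclusion of supports gives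
`ρ = σ ^ (1/2) X σ ^ (1/2) ≤ ‖X‖ σ`. -/
lemma exists_le_smul_of_supp_le {ρ σ : Matrix n n ℂ} (hρ : ρ.PosSemidef) (hσ : σ.PosSemidef)
    (h : supp ρ ≤ supp σ) : ∃ k : ℝ, 0 ≤ k ∧ ρ ≤ k • σ := by
  let s := matPow hσ.1 ((-1 / 2 : ℝ) : ℂ)
  let t := matPow hσ.1 ((1 / 2 : ℝ) : ℂ)
  have hs : s.PosSemidef := matPow_posSemidef hσ _
  have ht : t.PosSemidef := matPow_posSemidef hσ _
  have hX : (s * ρ * s).PosSemidef := by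
    simpa only [hs.1.eq] using hρ.mul_mul_conjTranspose_same s
  refine ⟨‖s * ρ * s‖, norm_nonneg _, Matrix.le_iff.2 ?_⟩
  have h1 := (Matrix.le_iff.1 (le_norm_smul_one hX)).mul_mul_conjTranspose_same t
  have hts : t * s = matPow hσ.1 0 := by
    rw [matPow_mul]; congr 1; push_cast; ring
  have hst : s * t = matPow hσ.1 0 := by
    rw [matPow_mul]; congr 1; push_cast; ring
  have htt : t * t = σ := by
    rw [matPow_mul, ← Complex.ofReal_add]; norm_num [matPow_one]
  have h2 : t * (s * ρ * s) * t = ρ := by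
    calc t * (s * ρ * s) * t = (t * s) * ρ * (s * t) := by simp only [mul_assoc]
      _ = ρ := by
        rw [hts, hst, matPow_zero_mul_of_supp_le hσ.1 h, mul_matPow_zero_of_supp_le hρ.1 hσ h]
  rwa [ht.1.eq, mul_sub, sub_mul, h2, Matrix.mul_smul, Matrix.smul_mul, mul_one, htt] at h1

/-! ### The relative entropy -/

/-- If `f` lies below `g` to the left of a point where they agree, its derivative there is
larger. -/
lemma deriv_ge_of_le_left {f g : ℝ → ℝ} {f' g' a b : ℝ} (hab : a < b)
    (hf : HasDerivAt f f' b) (hg : HasDerivAt g g' b) (hfg : ∀ x ∈ Set.Ioo a b, f x ≤ g x)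
    (h : f b = g b) : g' ≤ f' := by
  have h1 := (hasDerivAt_iff_tendsto_slope.1 (hf.sub hg)).mono_left
    (nhdsWithin_mono b (fun x (hx : x ∈ Set.Iio b) => ne_of_lt hx))
  refine sub_nonneg.1 (ge_of_tendsto h1 ?_)
  filter_upwards [Ioo_mem_nhdsLT hab] with x hx
  rw [slope_def_field]
  refine div_nonneg_of_nonpos ?_ (sub_nonpos.2 hx.2.le)
  have := hfg x hx
  simp only [Pi.sub_apply]
  linarith

/-- With `R = ρ` and `W = Φ ρ` the interpolated function satisfies `F θ ≤ c ^ (1 - θ)` on `[0, 1]`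
with equality at `θ = 1`, and comparing the derivatives there gives the inequality of relative
entropies. -/
theorem relEntropy_real_le (hΦ : ∀ X, X.PosSemidef → (Φ X).PosSemidef)
    (htr : ∀ X, (Φ X).trace = X.trace) {ρ T : Matrix n n ℂ} {S : Matrix m m ℂ}
    (hρ : IsState ρ) (hT : T.PosSemidef) (hS : S.PosSemidef) {c : ℝ} (hc : 0 < c)
    (hST : Φ T ≤ c • S) (hρT : supp ρ ≤ supp T) (hωS : supp (Φ ρ) ≤ supp S) :
    (Φ ρ * (psdLog (Φ ρ) - psdLog S)).trace.re ≤
      (ρ * (psdLog ρ - psdLog T)).trace.re + Real.logb 2 c := by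
  have hR := hρ.posSemidef
  have hW := hΦ _ hR
  set ω := Φ ρ with hω
  have hωtr : ω.trace = 1 := by rw [hω, htr, hρ.trace_eq_one]
  set LS := spectralFun hS.1 (fun x => Complex.log x) with hLS
  set LW := spectralFun hW.1 (fun x => Complex.log x) with hLW
  set LT := spectralFun hT.1 (fun x => Complex.log x) with hLT
  set LR := spectralFun hR.1 (fun x => Complex.log x) with hLR
  set p := matPow hS.1 0 with hp
  set q := matPow hW.1 0 with hq
  set r := matPow hT.1 0 with hr
  have pω : p * ω = ω := matPow_zero_mul_of_supp_le hS.1 hωS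
  have ωp : ω * p = ω := mul_matPow_zero_of_supp_le hW.1 hS hωS
  have qω : q * ω = ω := matPow_zero_mul hW.1
  have ωq : ω * q = ω := mul_matPow_zero hW.1
  have rρ : r * ρ = ρ := matPow_zero_mul_of_supp_le hT.1 hρT
  have ρr : ρ * r = ρ := mul_matPow_zero_of_supp_le hR.1 hT hρT
  have hqW : q = ω * matPow hW.1 (-1) := by
    have := matPow_mul hW.1 1 (-1)
    rw [matPow_one] at this
    rw [this]; norm_num [hq]
  have hqW' : q = matPow hW.1 (-1) * ω := by
    have := matPow_mul hW.1 (-1) 1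
    rw [matPow_one] at this
    rw [this]; norm_num [hq]
  have pq : p * q = q := by rw [hqW, ← mul_assoc, pω]
  have qp : q * p = q := by rw [hqW', mul_assoc, ωp]
  have e1 : (1 / 2 * 1 + -1 / 2 : ℂ) = 0 := by norm_num
  have e2 : (-1 * 1 + 1 : ℂ) = 0 := by norm_num
  have e3 : (-1 / 2 * 1 + 1 / 2 : ℂ) = 0 := by norm_num
  have e4 : (1 * 1 + 0 : ℂ) = 1 := by norm_num
  have hH := hasDerivAt_outerFamily hS hW 1
  have hG := hasDerivAt_innerFamily hT hR 1
  have hH1 : outerFamily hS hW 1 = q := by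
    rw [outerFamily, e1, e2, pq, qp]
  have hG1 : innerFamily hT hR 1 = ρ := by
    rw [innerFamily, e3, e4, matPow_one, rρ, ρr]
  rw [e1, e2] at hH
  rw [e3, e4, matPow_one] at hG
  have hF := hasDerivAt_interpFun Φ hS hW hT hR hH hG
  rw [hH1, hG1] at hF
  have hF1 : interpFun Φ hS hW hT hR 1 = 1 := by
    rw [interpFun, hH1, hG1, ← hω, qω, hωtr]
  -- The complement of the support projection of `Φ ρ` is invisible to `Φ (ρ Z)` and `Φ (Y ρ)`.
  let N := traceDual Φ (1 - q)
  have hN : N.PosSemidef := traceDual_posSemidef hΦ (one_sub_matPow_zero_posSemidef hW.1)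
  have hNρ : N * ρ = 0 := by
    refine PosSemidef.mul_eq_zero_of_trace_mul_eq_zero hN hR ?_
    rw [trace_traceDual_mul, ← hω, sub_mul, one_mul, qω, sub_self, trace_zero]
  have hρN : ρ * N = 0 := by
    have := congr_arg conjTranspose hNρ
    rwa [conjTranspose_mul, hN.1.eq, hR.1.eq, conjTranspose_zero] at this
  have hqΦ (X : Matrix n n ℂ) (h : (N * X).trace = 0) : (q * Φ X).trace = X.trace := by
    rw [trace_traceDual_mul, sub_mul, one_mul, trace_sub, htr, sub_eq_zero] at h
    exact h.symm
  have hleft : (((((1 / 2 : ℂ) • (p * LS)) * q + p * ((-1 : ℂ) • (q * LW))) * p +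
      p * q * ((1 / 2 : ℂ) • (p * LS))) * ω).trace = (LS * ω).trace - (LW * ω).trace := by
    have t1 : (p * LS * q * p * ω).trace = (LS * ω).trace := by
      rw [mul_assoc _ p, pω, mul_assoc _ q, qω, mul_assoc, trace_mul_comm, mul_assoc, ωp]
    have t2 : (p * (q * LW) * p * ω).trace = (LW * ω).trace := by
      rw [mul_assoc _ p, pω, ← mul_assoc, pq, mul_assoc, trace_mul_comm, mul_assoc, ωq]
    have t3 : (p * q * (p * LS) * ω).trace = (LS * ω).trace := by
      rw [pq, ← mul_assoc, qp, mul_assoc, trace_mul_comm, mul_assoc, ωq]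
    simp only [add_mul, Matrix.smul_mul, Matrix.mul_smul, trace_add, trace_smul, smul_eq_mul,
      t1, t2, t3]
    ring
  have hright : (q * Φ ((((-1 / 2 : ℂ) • (r * LT)) * ρ + r * ((1 : ℂ) • (ρ * LR))) * r +
      r * ρ * ((-1 / 2 : ℂ) • (r * LT)))).trace = (ρ * LR).trace - (LT * ρ).trace := by
    have t1 : (r * LT * ρ).trace = (LT * ρ).trace := by
      rw [mul_assoc, trace_mul_comm, mul_assoc, ρr]
    have t2 : (ρ * LR * r).trace = (ρ * LR).trace := by
      rw [trace_mul_comm, ← mul_assoc, rρ]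
    have t3 : (ρ * LT).trace = (LT * ρ).trace := trace_mul_comm _ _
    have s1 : (N * (r * LT * ρ)).trace = 0 := by
      rw [trace_mul_comm, mul_assoc, hρN, mul_zero, trace_zero]
    have s2 : (N * (ρ * LR * r)).trace = 0 := by
      rw [← mul_assoc, ← mul_assoc, hNρ, zero_mul, zero_mul, trace_zero]
    have s3 : (N * (ρ * LT)).trace = 0 := by
      rw [← mul_assoc, hNρ, zero_mul, trace_zero]
    have hX : (((-1 / 2 : ℂ) • (r * LT)) * ρ + r * ((1 : ℂ) • (ρ * LR))) * r +
        r * ρ * ((-1 / 2 : ℂ) • (r * LT)) =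
        (-1 / 2 : ℂ) • (r * LT * ρ) + ρ * LR * r + (-1 / 2 : ℂ) • (ρ * LT) := by
      rw [one_smul, rρ, ← mul_assoc r ρ, rρ, add_mul, Matrix.smul_mul, Matrix.smul_mul,
        mul_assoc _ ρ r, ρr, Matrix.mul_smul, ← mul_assoc ρ r, ρr]
    rw [hX, hqΦ]
    · simp only [trace_add, trace_smul, t1, t2, t3, smul_eq_mul]; ring
    · simp only [mul_add, Matrix.mul_smul, trace_add, trace_smul, s1, s2, s3]; simp
  rw [hleft, hright] at hF
  -- `tr (ω log S) - tr (ω log ω) + tr (ρ log ρ) - tr (ρ log T)` is the derivative of `F` at `1`.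
  have hFr := HasDerivAt.real_of_complex (z := 1) (by simpa using hF)
  have hcd : HasDerivAt (fun θ : ℝ => c ^ (1 - θ)) (-Real.log c) 1 := by
    have := ((hasDerivAt_id (1 : ℝ)).const_sub 1).const_rpow hc
    simpa using this
  have key := deriv_ge_of_le_left zero_lt_one hFr hcd (fun θ hθ => by
    have h := norm_interpFun_le hΦ htr hS hW hT hR hc (Matrix.le_iff.1 hST) hθ.1.le hθ.2.le
    rw [hωtr, hρ.trace_eq_one] at h
    simpa using (Complex.re_le_norm _).trans h) (by simp [hF1])
  rw [hLS, hLW, hLT, hLR, spectralFun_log hS, spectralFun_log hW, spectralFun_log hT,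
    spectralFun_log hR] at key
  have hlog2 := Real.log_pos one_lt_two
  simp only [Matrix.smul_mul, Matrix.mul_smul, trace_smul, smul_eq_mul, Complex.add_re,
    Complex.sub_re, Complex.re_ofReal_mul] at key
  rw [trace_mul_comm _ ω, trace_mul_comm _ ω, trace_mul_comm _ ρ] at key
  rw [Real.logb, mul_sub, mul_sub, trace_sub, trace_sub, Complex.sub_re, Complex.sub_re,
    ← sub_le_iff_le_add', le_div_iff₀ hlog2]
  linarith

/-! ### The sandwiched Rényi divergence -/

lemma sandwich_posSemidef {τ Q : Matrix n n ℂ} (hτ : τ.PosSemidef) (hQ : Q.PosSemidef) (s : ℝ) :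
    (psdPow Q s * τ * psdPow Q s).PosSemidef := by
  simpa only [(psdPow_posSemidef hQ s).1.eq] using hτ.mul_mul_conjTranspose_same (psdPow Q s)

/-- Conjugation by `Q ^ (-s)` undoes conjugation by `Q ^ s` on the support of `Q`. -/
lemma matPow_neg_sandwich {τ Q : Matrix n n ℂ} (hτ : τ.PosSemidef) (hQ : Q.PosSemidef)
    (h : supp τ ≤ supp Q) {s : ℝ} (hs : s ≠ 0) :
    matPow hQ.1 ((-s : ℝ) : ℂ) * (psdPow Q s * τ * psdPow Q s) * matPow hQ.1 ((-s : ℝ) : ℂ)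
      = τ := by
  rw [← matPow_ofReal hQ hs]
  calc _ = (matPow hQ.1 ((-s : ℝ) : ℂ) * matPow hQ.1 (s : ℂ)) * τ *
      (matPow hQ.1 (s : ℂ) * matPow hQ.1 ((-s : ℝ) : ℂ)) := by simp only [mul_assoc]
    _ = τ := by
      rw [matPow_mul, matPow_mul, Complex.ofReal_neg, neg_add_cancel, add_neg_cancel,
        matPow_zero_mul_of_supp_le hQ.1 h, mul_matPow_zero_of_supp_le hτ.1 hQ h]

/-- With `A = T ^ s ρ T ^ s` and `Y = S ^ s (Φ ρ) S ^ s`, interpolating for `R = A ^ α` and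
`W = Y ^ α` at `θ = 1 / α` bounds `tr (Y ^ α)` by
`(c * tr (Y ^ α)) ^ (1 - 1 / α) * (tr (A ^ α)) ^ (1 / α)`. -/
theorem sandwichedRenyi_real_le (hΦ : ∀ X, X.PosSemidef → (Φ X).PosSemidef)
    (htr : ∀ X, (Φ X).trace = X.trace) {ρ T : Matrix n n ℂ} {S : Matrix m m ℂ}
    (hρ : IsState ρ) (hT : T.PosSemidef) (hS : S.PosSemidef) {c : ℝ} (hc : 0 < c)
    (hST : Φ T ≤ c • S) (hρT : supp ρ ≤ supp T) (hωS : supp (Φ ρ) ≤ supp S) {α : ℝ} (hα : 1 < α) :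
    (α - 1)⁻¹ * Real.logb 2 (psdPow (psdPow S ((1 - α) / (2 * α)) * Φ ρ *
        psdPow S ((1 - α) / (2 * α))) α).trace.re ≤
      (α - 1)⁻¹ * Real.logb 2 (psdPow (psdPow T ((1 - α) / (2 * α)) * ρ *
        psdPow T ((1 - α) / (2 * α))) α).trace.re + Real.logb 2 c := by
  have hα0 : 0 < α := by linarith
  have hω := hΦ _ hρ.posSemidef
  set s := (1 - α) / (2 * α) with hs
  have hs0 : s ≠ 0 := div_ne_zero (by linarith) (by linarith)
  have hA := sandwich_posSemidef hρ.posSemidef hT s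
  have hY := sandwich_posSemidef hω hS s
  have hAρ := matPow_neg_sandwich hρ.posSemidef hT hρT hs0
  have hYω := matPow_neg_sandwich hω hS hωS hs0
  set A := psdPow T s * ρ * psdPow T s with hAdef
  set Y := psdPow S s * Φ ρ * psdPow S s with hYdef
  have hR := psdPow_posSemidef hA α
  have hW := psdPow_posSemidef hY α
  have hinner : innerFamily hT hR ((1 / α : ℝ) : ℂ) = ρ := by
    have e1 : matPow hT.1 (-1 / 2 * ((1 / α : ℝ) : ℂ) + 1 / 2) = matPow hT.1 ((-s : ℝ) : ℂ) := by
      congr 1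
      have : -s = -1 / 2 * (1 / α) + 1 / 2 := by rw [hs]; field_simp; ring
      rw [this]; push_cast; ring
    have e2 : matPow hR.1 (1 * ((1 / α : ℝ) : ℂ) + 0) = A := by
      rw [one_mul, add_zero, matPow_ofReal hR (by positivity), psdPow_psdPow hA,
        mul_one_div_cancel hα0.ne', psdPow_one hA]
    rw [innerFamily, e1, e2, hAρ]
  have houter : outerFamily hS hW ((1 / α : ℝ) : ℂ) =
      psdPow S s * psdPow Y (α - 1) * psdPow S s := by
    have e1 : matPow hS.1 (1 / 2 * ((1 / α : ℝ) : ℂ) + -1 / 2) = psdPow S s := by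
      rw [← matPow_ofReal hS hs0]
      congr 1
      have : s = 1 / 2 * (1 / α) + -1 / 2 := by rw [hs]; field_simp; ring
      rw [this]; push_cast; ring
    have e2 : matPow hW.1 (-1 * ((1 / α : ℝ) : ℂ) + 1) = psdPow Y (α - 1) := by
      have h1 : (-1 * ((1 / α : ℝ) : ℂ) + 1) = ((1 - 1 / α : ℝ) : ℂ) := by push_cast; ring
      have h2 : 1 - 1 / α ≠ 0 := by
        have := (div_lt_one hα0).2 hα
        linarith
      rw [h1, matPow_ofReal hW h2, psdPow_psdPow hY]
      congr 1
      field_simp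
    rw [outerFamily, e1, e2]
  have hF : interpFun Φ hS hW hT hR ((1 / α : ℝ) : ℂ) = (psdPow Y α).trace := by
    have h1 : psdPow Y (α - 1) * (psdPow S s * Φ ρ * psdPow S s) = psdPow Y α := by
      rw [← hYdef]
      have := matPow_mul hY.1 ((α - 1 : ℝ) : ℂ) 1
      rw [matPow_one, matPow_ofReal hY (by linarith)] at this
      rw [this, ← matPow_ofReal hY hα0.ne']
      congr 1; push_cast; ring
    rw [interpFun, hinner, houter, ← h1]
    have := trace_mul_comm (psdPow S s) (psdPow Y (α - 1) * psdPow S s * Φ ρ)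
    simpa only [mul_assoc] using this
  have hbound := norm_interpFun_le hΦ htr hS hW hT hR hc (Matrix.le_iff.1 hST)
    (θ := 1 / α) (by positivity) ((div_le_one hα0).2 hα.le)
  rw [hF] at hbound
  have hx0 : 0 ≤ (psdPow Y α).trace.re := (Complex.le_def.1 hW.trace_nonneg).1
  have hy0 : 0 ≤ (psdPow A α).trace.re := (Complex.le_def.1 hR.trace_nonneg).1
  -- Dividing by a power of `tr (Y ^ α)`, and taking its logarithm, requires it to be nonzero.
  have hx : (psdPow Y α).trace.re ≠ 0 := by
    intro h
    have h1 : psdPow Y α = 0 := hW.trace_eq_zero_iff.1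
      (Complex.ext h (Complex.le_def.1 hW.trace_nonneg).2.symm)
    have h2 : Y = 0 := by
      rw [← psdPow_one hY, ← mul_one_div_cancel hα0.ne', ← psdPow_psdPow hY, h1, psdPow,
        cfc_apply_zero, Real.zero_rpow (by positivity), map_zero]
    rw [h2, mul_zero, zero_mul] at hYω
    have := htr ρ
    rw [← hYω, hρ.trace_eq_one, trace_zero] at this
    exact zero_ne_one this
  have hle := (Complex.re_le_norm _).trans hbound
  set x := (psdPow Y α).trace.re
  set y := (psdPow A α).trace.re
  have hx' : 0 < x := lt_of_le_of_ne hx0 (Ne.symm hx)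
  have hy' : 0 < y := by
    refine lt_of_le_of_ne hy0 fun h => ?_
    rw [← h, Real.zero_rpow (by positivity), mul_zero] at hle
    linarith
  have hlog := Real.log_le_log hx' hle
  rw [Real.log_mul (by positivity) (by positivity), Real.log_rpow (by positivity),
    Real.log_rpow hy', Real.log_mul hc.ne' hx] at hlog
  have hlog2 := Real.log_pos one_lt_two
  have hα1 : 0 < α - 1 := by linarith
  have h3 : Real.log x ≤ Real.log y + (α - 1) * Real.log c := by
    have := mul_le_mul_of_nonneg_left hlog hα0.le
    have e : α * ((1 - 1 / α) * (Real.log c + Real.log x) + 1 / α * Real.log y) =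
        (α - 1) * (Real.log c + Real.log x) + Real.log y := by field_simp
    rw [e] at this
    linarith
  rw [Real.logb, Real.logb, Real.logb]
  have h4 : (α - 1)⁻¹ * (Real.log y / Real.log 2) + Real.log c / Real.log 2 =
      (α - 1)⁻¹ * ((Real.log y + (α - 1) * Real.log c) / Real.log 2) := by field_simp
  rw [h4]
  gcongr

/-! ### The divergences as extended reals -/

lemma Dmax_nonneg {k : Type*} [Fintype k] [DecidableEq k] (ρ σ : Matrix k k ℂ) : 0 ≤ Dmax ρ σ :=
  le_iInf₂ fun _ h => EReal.coe_nonneg.2 h.1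

/-- To bound by `b + Dmax τ σ` it suffices to treat each feasible exponent in the infimum
defining `Dmax`. -/
lemma le_add_Dmax {k : Type*} [Fintype k] [DecidableEq k] {τ σ : Matrix k k ℂ} {a b : EReal}
    (hb : b ≠ ⊥) (h : ∀ l : ℝ, 0 ≤ l → τ ≤ (2 : ℝ) ^ l • σ → a ≤ b + l) :
    a ≤ b + Dmax τ σ := by
  have hD : Dmax τ σ ≠ ⊥ := ne_bot_of_le_ne_bot EReal.zero_ne_bot (Dmax_nonneg τ σ)
  rw [add_comm, ← EReal.sub_le_iff_le_add (Or.inl hb) (Or.inr hD)]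
  refine le_iInf₂ fun l hl => ?_
  rw [EReal.sub_le_iff_le_add (Or.inl hb) (Or.inr (EReal.coe_ne_bot l)), add_comm]
  exact h l hl.1 hl.2

lemma renyiDiv_ne_bot (α : ℝ≥0∞) (ρ σ : Matrix n n ℂ) : renyiDiv α ρ σ ≠ ⊥ := by
  unfold renyiDiv relEntropy sandwichedRenyi
  split_ifs
  · exact EReal.coe_ne_bot _
  · exact top_ne_bot
  · exact ne_bot_of_le_ne_bot EReal.zero_ne_bot (Dmax_nonneg ρ σ)
  · exact EReal.coe_ne_bot _
  · exact top_ne_bot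

end Quantum

end

theorem theorem1 {A B : Type*} [Fintype A] [DecidableEq A] [Fintype B] [DecidableEq B]
    (P : Matrix A A ℂ →ₚ[ℂ] Matrix B B ℂ) (hP : ∀ X : Matrix A A ℂ, (P X).trace = X.trace)
    (α : ℝ≥0∞) (hα : 1 ≤ α)
    (ρ σ' : Matrix A A ℂ) (σ : Matrix B B ℂ)
    (hρ : Quantum.IsState ρ) (hσ' : Quantum.IsState σ') (hσ : Quantum.IsState σ) :
    Quantum.renyiDiv α (P ρ) σ ≤ Quantum.renyiDiv α ρ σ' + Quantum.Dmax (P σ') σ := by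
  refine Quantum.le_add_Dmax (Quantum.renyiDiv_ne_bot α ρ σ') fun l hl hle => ?_
  let Φ : Matrix A A ℂ →ₗ[ℂ] Matrix B B ℂ := P.toLinearMap
  have hΦ (X : Matrix A A ℂ) (hX : X.PosSemidef) : (Φ X).PosSemidef :=
    Matrix.nonneg_iff_posSemidef.1 (map_nonneg P hX.nonneg)
  have hc : (0 : ℝ) < 2 ^ l := by positivity
  have hlogb : Real.logb 2 ((2 : ℝ) ^ l) = l := Real.logb_rpow (by norm_num) (by norm_num)
  have hmono {k : ℝ} (hk : 0 ≤ k) (h : ρ ≤ k • σ') : P ρ ≤ (k * 2 ^ l) • σ := by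
    have h1 := OrderHomClass.mono P h
    have h2 : P (k • σ') = k • P σ' := by
      rw [← Complex.coe_smul, map_smul, Complex.coe_smul]
    rw [h2] at h1
    rw [mul_smul]
    exact h1.trans (smul_le_smul_of_nonneg_left hle hk)
  have hsupp (h : Quantum.supp ρ ≤ Quantum.supp σ') : Quantum.supp (P ρ) ≤ Quantum.supp σ := by
    obtain ⟨k, hk, h1⟩ := Quantum.exists_le_smul_of_supp_le hρ.posSemidef hσ'.posSemidef h
    exact Quantum.supp_le_of_le_smul (hΦ _ hρ.posSemidef) hσ.posSemidef.1 (hmono hk h1)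
  unfold Quantum.renyiDiv
  split_ifs with h1 h2
  · unfold Quantum.relEntropy
    by_cases h : Quantum.supp ρ ≤ Quantum.supp σ'
    · rw [if_pos h, if_pos (hsupp h), ← EReal.coe_add, EReal.coe_le_coe_iff]
      have := Quantum.relEntropy_real_le hΦ hP hρ hσ'.posSemidef hσ.posSemidef hc hle h (hsupp h)
      rwa [hlogb] at this
    · rw [if_neg h, EReal.top_add_coe]
      exact le_top
  · rw [← EReal.sub_le_iff_le_add (Or.inl (EReal.coe_ne_bot l)) (Or.inl (EReal.coe_ne_top l))]
    refine le_iInf₂ fun k hk => ?_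
    rw [EReal.sub_le_iff_le_add (Or.inl (EReal.coe_ne_bot l)) (Or.inl (EReal.coe_ne_top l)),
      ← EReal.coe_add]
    refine iInf₂_le (k + l) ⟨add_nonneg hk.1 hl, ?_⟩
    rw [Real.rpow_add two_pos]
    exact hmono (by positivity) hk.2
  · unfold Quantum.sandwichedRenyi
    by_cases h : Quantum.supp ρ ≤ Quantum.supp σ'
    · rw [if_pos h, if_pos (hsupp h), ← EReal.coe_add, EReal.coe_le_coe_iff]
      have hα' : 1 < α.toReal := by
        have := (ENNReal.toReal_lt_toReal ENNReal.one_ne_top h2).2 (lt_of_le_of_ne hα (Ne.symm h1))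
        simpa using this
      have := Quantum.sandwichedRenyi_real_le hΦ hP hρ hσ'.posSemidef hσ.posSemidef hc hle h
        (hsupp h) hα'
      rwa [hlogb] at this
    · rw [if_neg h, EReal.top_add_coe]
      exact le_top
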